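/- Let $X$ be a compact space and $C(X)$ the vector lattice of continuous real-valued functions on $X$. Let $E$ be a real topological vector space that is also a vector lattice (no compatibility between the topology and the order is assumed), let $F$ be a locally convex vector lattice (that is, a real vector lattice with a locally convex vector space topology for which $0$ has a neighbourhood base of solid sets), and let $T: C(X)\to E$ be a lattice homomorphism, i.e. a linear map preserving finite suprema and infima. Let $T_n: E\to F$, $n\in\mathbb N$, be an equicontinuous sequence of positive linear maps and let $P: E\to F$ be a continuous lattice homomorphism. Let $S\subset C(X)$ contain a strictly positive function and let $G=\operatorname{lin} S$ be its linear span. Let $$\operatorname{supp}(P\circ T)=\{x\in X : f(x)=0 \text{ for all } f\in C(X) \text{ with } P(T|f|)=0\}$$ be the support of $P\circ T: C(X)\to F$, and for $K\subset X$ let $$\hat G_K=\{f\in C(X) : \mu(f)=f(x)\text{ for all }x\in K\text{ and all positive linear forms }\mu\text{ on }C(X)\text{ with }\mu(g)=g(x)\text{ for all }g\in G\}.$$ If $$T_n(Tg)\to P(Tg)\quad\text{in } F\text{ for all } g\in S,$$ then $$T_n f\to Pf\quad\text{in } F\text{ for all } f\in\overline{T\bigl(\hat G_{\operatorname{supp}(P\circ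 T)}\bigr)}^{E},$$ where the closure is taken in $E$. -/

import Mathlib

open Filter Topology

/-- A topological vector lattice is locally solid if `0` has a neighbourhood base of solid sets
(`s` is solid if `x ∈ s` and `|y| ≤ |x|` imply `y ∈ s`). A locally convex vector lattice is a
vector lattice with a vector space topology that is locally convex and locally solid. -/
class LocallySolidSpace (F : Type*) [AddCommGroup F] [Lattice F] [TopologicalSpace F] : Prop where
  exists_solid_subset : ∀ U ∈ 𝓝 (0 : F), ∃ V ∈ 𝓝 (0 : F),
    LatticeOrderedAddCommGroup.IsSolid V ∧ V ⊆ U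

/-- A lattice homomorphism between vector lattices: a linear map preserving binary suprema and
infima. -/
structure IsVectorLatticeHom {V W : Type*} [AddCommGroup V] [Module ℝ V] [Lattice V]
    [AddCommGroup W] [Module ℝ W] [Lattice W] (T : V →ₗ[ℝ] W) : Prop where
  map_sup : ∀ x y, T (x ⊔ y) = T x ⊔ T y
  map_inf : ∀ x y, T (x ⊓ y) = T x ⊓ T y

/-- The support of a positive linear map `L` on `C(X)`: the set of common zeros of its null ideal
`{f | L |f| = 0}`. -/
def mapSupport {X : Type*} [TopologicalSpace X] {F : Type*} [AddCommGroup F] [Module ℝ F]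
    (L : C(X, ℝ) →ₗ[ℝ] F) : Set X :=
  {x | ∀ f : C(X, ℝ), L |f| = 0 → f x = 0}

/-- The extension space `Ĝ_K` of a linear subspace `G` of `C(X)` with respect to `K ⊆ X`: all `f`
such that `μ f = f x` whenever `x ∈ K` and `μ` is a positive linear form on `C(X)` with
`μ g = g x` for all `g ∈ G`. -/
def extensionSpace {X : Type*} [TopologicalSpace X] (G : Submodule ℝ C(X, ℝ)) (K : Set X) :
    Set C(X, ℝ) :=
  {f | ∀ x ∈ K, ∀ μ : C(X, ℝ) →ₚ[ℝ] ℝ, (∀ g ∈ G, μ g = g x) → μ f = f x}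

/-!
Write `L = P ∘ T` and `G = span S`. The set of points where an equicontinuous sequence converges to
a continuous map is closed, so it suffices to treat `T f` with `f` in the extension space of `G`
with respect to the support `K` of `L`.

At a point `x ∈ K`, the Hahn–Banach theorem applied to the sublinear functional
`h ↦ inf {g x | g ∈ G, h ≤ g}` shows that `f x` is the infimum of the values `g x` of the functions
`g ∈ G` lying above `f` (`exists_mem_le_apply_lt`). At a point `x ∉ K` there is a function `h` with
`L |h| = 0` and `h x ≠ 0`, so a large multiple of `|h|` bounds `g - f` at `x` for any `g ∈ G`. By
compactness a finite infimum `q` of functions `g ∈ G` above `f` satisfies `q ≤ f + ε + w` everywhere,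
where `w ≥ 0` and `L w = 0`. Since `L` is a lattice homomorphism, `L q` is the infimum of the `L g`,
and therefore `T_n (T f) ≤ L q + s_n ≤ L f + ε L 1 + s_n` with `s_n → 0`
(`exists_tendsto_zero_le_add`). The same bound for `-f` and the local solidity of `F` give the
convergence.
-/

section LocallySolid

variable {F : Type*} [AddCommGroup F] [Lattice F]

theorem tendsto_abs_zero [IsOrderedAddMonoid F] [TopologicalSpace F] [LocallySolidSpace F]
    {ι : Type*} {l : Filter ι} {u : ι → F} (hu : Tendsto u l (𝓝 0)) :
    Tendsto (fun i => |u i|) l (𝓝 0) := by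
  refine tendsto_def.2 fun U hU => ?_
  obtain ⟨V, hV, hsolid, hVU⟩ := LocallySolidSpace.exists_solid_subset U hU
  filter_upwards [hu.eventually_mem hV] with i hi
  exact hVU (hsolid hi (abs_abs _).le)

/-- If `|u n|` is dominated, for each `ε > 0`, by `ε • a` plus a null sequence, then `u` is itself a
null sequence. -/
theorem tendsto_zero_of_forall_abs_le [Module ℝ F] [TopologicalSpace F] [ContinuousAdd F]
    [ContinuousSMul ℝ F] [LocallySolidSpace F] {ι : Type*} {l : Filter ι} {u : ι → F} (a : F)
    (h : ∀ ε : ℝ, 0 < ε → ∃ s : ι → F, Tendsto s l (𝓝 0) ∧ ∀ i, |u i| ≤ ε • a + s i) :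
    Tendsto u l (𝓝 0) := by
  refine tendsto_def.2 fun U hU => ?_
  obtain ⟨V, hV, hsolid, hVU⟩ := LocallySolidSpace.exists_solid_subset U hU
  obtain ⟨W, hW, hWV⟩ := exists_nhds_zero_half hV
  have hsmul : Tendsto (fun ε : ℝ => ε • a) (𝓝[>] 0) (𝓝 0) := by
    have : Tendsto (fun ε : ℝ => ε • a) (𝓝 0) (𝓝 ((0 : ℝ) • a)) :=
      (continuous_id.smul continuous_const).tendsto 0
    rw [zero_smul] at this
    exact this.mono_left nhdsWithin_le_nhds
  obtain ⟨ε, hεW, hε⟩ := ((hsmul.eventually hW).and self_mem_nhdsWithin).exists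
  obtain ⟨s, hs, hle⟩ := h ε hε
  filter_upwards [hs.eventually_mem hW] with i hi
  exact hVU (hsolid (hWV _ hεW _ hi) ((hle i).trans (le_abs_self _)))

end LocallySolid

namespace IsVectorLatticeHom

variable {U V W : Type*} [AddCommGroup U] [Module ℝ U] [Lattice U] [AddCommGroup V] [Module ℝ V]
  [Lattice V] [AddCommGroup W] [Module ℝ W] [Lattice W]

theorem monotone {T : V →ₗ[ℝ] W} (hT : IsVectorLatticeHom T) : Monotone T := fun x y hxy => by
  rw [← sup_eq_right, ← hT.map_sup, sup_eq_right.2 hxy]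

theorem comp {T : V →ₗ[ℝ] W} {R : U →ₗ[ℝ] V} (hT : IsVectorLatticeHom T)
    (hR : IsVectorLatticeHom R) : IsVectorLatticeHom (T ∘ₗ R) where
  map_sup x y := by simp [hR.map_sup, hT.map_sup]
  map_inf x y := by simp [hR.map_inf, hT.map_inf]

end IsVectorLatticeHom

section ContinuousMap

variable {X : Type*} [TopologicalSpace X]

theorem exists_mem_ge_of_pos_mem [CompactSpace X] {G : Submodule ℝ C(X, ℝ)}
    {e : C(X, ℝ)} (heG : e ∈ G) (he : ∀ x, 0 < e x) (f : C(X, ℝ)) : ∃ g ∈ G, f ≤ g := by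
  have hcont : Continuous fun x => f x / e x := f.continuous.div e.continuous fun x => (he x).ne'
  obtain ⟨c, hc⟩ := (isCompact_range hcont).bddAbove
  refine ⟨c • e, G.smul_mem c heG, fun x => ?_⟩
  have := hc ⟨x, rfl⟩
  simpa using (div_le_iff₀ (he x)).1 this

theorem neg_mem_extensionSpace {G : Submodule ℝ C(X, ℝ)} {K : Set X} {f : C(X, ℝ)}
    (hf : f ∈ extensionSpace G K) : -f ∈ extensionSpace G K := fun x hx μ hμ => by
  rw [map_neg, hf x hx μ hμ, ContinuousMap.neg_apply]

/-- If `G` contains a strictly positive function, then at every point of `K` an element of the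
extension space of `G` with respect to `K` is the infimum of its majorants from `G`. -/
theorem exists_mem_le_apply_lt [CompactSpace X] {G : Submodule ℝ C(X, ℝ)}
    {e : C(X, ℝ)} (heG : e ∈ G) (he : ∀ x, 0 < e x) {K : Set X} {f : C(X, ℝ)}
    (hf : f ∈ extensionSpace G K) {x : X} (hx : x ∈ K) {ε : ℝ} (hε : 0 < ε) :
    ∃ g ∈ G, f ≤ g ∧ g x < f x + ε := by
  by_contra! hcon
  have hf0 : f ≠ 0 := by
    rintro rfl
    have := hcon 0 G.zero_mem le_rfl
    simp only [ContinuousMap.zero_apply, zero_add] at this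
    exact absurd hε this.not_gt
  let D : C(X, ℝ) → Set ℝ := fun h => (fun g : C(X, ℝ) => g x) '' {g | g ∈ G ∧ h ≤ g}
  have hDne : ∀ h, (D h).Nonempty := fun h => by
    obtain ⟨g, hg, hhg⟩ := exists_mem_ge_of_pos_mem heG he h
    exact ⟨g x, g, ⟨hg, hhg⟩, rfl⟩
  have hDbdd : ∀ h, BddBelow (D h) := fun h => ⟨h x, by
    rintro _ ⟨g, ⟨-, hhg⟩, rfl⟩
    exact hhg x⟩
  let p : C(X, ℝ) → ℝ := fun h => sInf (D h)
  have hp_le : ∀ h, ∀ g ∈ G, h ≤ g → p h ≤ g x := fun h g hg hhg =>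
    csInf_le (hDbdd h) ⟨g, ⟨hg, hhg⟩, rfl⟩
  have hle_p : ∀ h (r : ℝ), (∀ g ∈ G, h ≤ g → r ≤ g x) → r ≤ p h := fun h r H =>
    le_csInf (hDne h) (by
      rintro _ ⟨g, ⟨hg, hhg⟩, rfl⟩
      exact H g hg hhg)
  have hp_smul_le : ∀ c : ℝ, 0 < c → ∀ h, c * p h ≤ p (c • h) := fun c hc h => by
    refine hle_p _ _ fun g hg hhg => ?_
    have := hp_le h (c⁻¹ • g) (G.smul_mem _ hg) <| ContinuousMap.le_def.2 fun y => by
      have := ContinuousMap.le_def.1 hhg y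
      simp only [ContinuousMap.smul_apply, smul_eq_mul] at this ⊢
      rwa [le_inv_mul_iff₀ hc]
    simp only [ContinuousMap.smul_apply, smul_eq_mul] at this
    rwa [le_inv_mul_iff₀ hc] at this
  have hp_smul : ∀ c : ℝ, 0 < c → ∀ h, p (c • h) = c * p h := fun c hc h => by
    refine le_antisymm ?_ (hp_smul_le c hc h)
    have := hp_smul_le c⁻¹ (inv_pos.2 hc) (c • h)
    rwa [smul_smul, inv_mul_cancel₀ hc.ne', one_smul, inv_mul_le_iff₀ hc] at this
  have hp_add : ∀ h k, p (h + k) ≤ p h + p k := fun h k => by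
    rw [← sub_le_iff_le_add]
    refine hle_p _ _ fun g hg hhg => ?_
    rw [sub_le_comm]
    refine hle_p _ _ fun g' hg' hkg' => ?_
    rw [sub_le_iff_le_add']
    exact hp_le _ (g + g') (G.add_mem hg hg') (add_le_add hhg hkg')
  have hp0 : p 0 = 0 := by
    have := hp_smul 2 two_pos 0
    rw [smul_zero] at this
    linarith
  -- A linear form `μ ≤ p` with `μ f = p f` is positive and agrees with evaluation at `x` on `G`, so
  -- `μ f = f x`, whereas `f x + ε ≤ p f`.
  obtain ⟨μ, hμf, hμp⟩ := exists_extension_of_le_sublinear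
    (LinearPMap.mkSpanSingleton (σ := RingHom.id ℝ) f (p f) hf0) p hp_smul hp_add (by
      rintro ⟨_, hy⟩
      obtain ⟨c, rfl⟩ := Submodule.mem_span_singleton.1 hy
      have hval : LinearPMap.mkSpanSingleton (σ := RingHom.id ℝ) f (p f) hf0 ⟨c • f, hy⟩ =
          c * p f :=
        LinearPMap.mkSpanSingleton'_apply _ _ _ c _
      refine hval.trans_le ?_
      rcases lt_trichotomy c 0 with hc | rfl | hc
      · have h1 := hp_add (c • f) ((-c) • f)
        rw [← add_smul, add_neg_cancel, zero_smul, hp0, hp_smul (-c) (neg_pos.2 hc)] at h1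
        linarith
      · simp [hp0]
      · exact (hp_smul c hc f).ge)
  have hμf' : μ f = p f :=
    (hμf ⟨f, Submodule.mem_span_singleton_self f⟩).trans
      (LinearPMap.mkSpanSingleton_apply ℝ ℝ hf0 (p f))
  have hμ_nonneg : ∀ h, 0 ≤ h → 0 ≤ μ h := fun h hh => by
    have h1 := (hμp (-h)).trans (hp_le (-h) 0 G.zero_mem (neg_nonpos.2 hh))
    rw [map_neg, ContinuousMap.zero_apply] at h1
    linarith
  have hμG : ∀ g ∈ G, μ g = g x := fun g hg => by
    have h1 := (hμp g).trans (hp_le g g hg le_rfl)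
    have h2 := (hμp (-g)).trans (hp_le (-g) (-g) (G.neg_mem hg) le_rfl)
    rw [map_neg, ContinuousMap.neg_apply] at h2
    linarith
  have hμx : μ f = f x := hf x hx (PositiveLinearMap.mk₀ μ hμ_nonneg) hμG
  have := hle_p f (f x + ε) hcon
  linarith

variable {F : Type*} [AddCommGroup F] [Module ℝ F] [Lattice F] [IsOrderedAddMonoid F]

/-- Up to a null sequence and a multiple of `ε`, the limit `L f` bounds `A n f` from above. -/
theorem exists_tendsto_zero_le_add [CompactSpace X] [TopologicalSpace F] [IsTopologicalAddGroup F]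
    [LocallySolidSpace F] {G : Submodule ℝ C(X, ℝ)} {e : C(X, ℝ)} (heG : e ∈ G)
    (he : ∀ x, 0 < e x) {L : C(X, ℝ) →ₗ[ℝ] F} (hL : IsVectorLatticeHom L)
    {ι : Type*} {l : Filter ι} {A : ι → C(X, ℝ) → F} (hA : ∀ i, Monotone (A i))
    (hconv : ∀ g ∈ G, Tendsto (fun i => A i g) l (𝓝 (L g))) {f : C(X, ℝ)}
    (hf : f ∈ extensionSpace G (mapSupport L)) {ε : ℝ} (hε : 0 < ε) :
    ∃ s : ι → F, Tendsto s l (𝓝 0) ∧ (∀ i, 0 ≤ s i) ∧ ∀ i, A i f ≤ L f + ε • L 1 + s i := by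
  -- The functions `q` whose image asymptotically dominates `A i f` contain the majorants of `f`
  -- in `G` and are stable under `⊓`, so compactness can be run without naming finite infima.
  let Q : Set C(X, ℝ) :=
    {q | ∃ s : ι → F, Tendsto s l (𝓝 0) ∧ (∀ i, 0 ≤ s i) ∧ ∀ i, A i f ≤ L q + s i}
  have hGQ : ∀ g ∈ G, f ≤ g → g ∈ Q := fun g hg hfg => by
    refine ⟨fun i => |A i g - L g|, tendsto_abs_zero ?_, fun i => abs_nonneg _, fun i => ?_⟩
    · simpa using (hconv g hg).sub_const (L g)
    · rw [← sub_le_iff_le_add']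
      exact (sub_le_sub_right (hA i hfg) _).trans (le_abs_self _)
  have hQinf : ∀ q ∈ Q, ∀ q' ∈ Q, q ⊓ q' ∈ Q := by
    rintro q ⟨s, hs, hs0, hsq⟩ q' ⟨s', hs', hs0', hsq'⟩
    refine ⟨fun i => s i + s' i, by simpa using hs.add hs', fun i => add_nonneg (hs0 i) (hs0' i),
      fun i => ?_⟩
    rw [hL.map_inf, ← sub_le_iff_le_add]
    refine le_inf ?_ ?_ <;> rw [sub_le_iff_le_add]
    · exact (hsq i).trans (add_le_add_right (le_add_of_nonneg_right (hs0' i)) _)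
    · exact (hsq' i).trans (add_le_add_right (le_add_of_nonneg_left (hs0 i)) _)
  obtain ⟨g₀, hg₀, hfg₀⟩ := exists_mem_ge_of_pos_mem heG he f
  obtain ⟨q, hq, w, -, hLw, hqw⟩ : ∃ q ∈ Q, ∃ w : C(X, ℝ), 0 ≤ w ∧ L w = 0 ∧
      ∀ x ∈ Set.univ, q x ≤ f x + ε + w x := by
    refine isCompact_univ.induction_on (p := fun t => ∃ q ∈ Q, ∃ w : C(X, ℝ), 0 ≤ w ∧ L w = 0 ∧
      ∀ x ∈ t, q x ≤ f x + ε + w x) ⟨g₀, hGQ g₀ hg₀ hfg₀, 0, le_rfl, map_zero L, by simp⟩ ?_ ?_ ?_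
    · rintro t t' htt' ⟨q, hq, w, hw, hLw, h⟩
      exact ⟨q, hq, w, hw, hLw, fun x hx => h x (htt' hx)⟩
    · rintro t t' ⟨q, hq, w, hw, hLw, h⟩ ⟨q', hq', w', hw', hLw', h'⟩
      refine ⟨q ⊓ q', hQinf q hq q' hq', w + w', add_nonneg hw hw', by simp [hLw, hLw'], ?_⟩
      have h0 : ∀ x, 0 ≤ w x := ContinuousMap.le_def.1 hw
      have h0' : ∀ x, 0 ≤ w' x := ContinuousMap.le_def.1 hw'
      rintro x (hx | hx)
      · have h1 := h x hx
        have h2 := h0' x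
        simp only [ContinuousMap.inf_apply, ContinuousMap.add_apply]
        exact inf_le_left.trans (by linarith)
      · have h1 := h' x hx
        have h2 := h0 x
        simp only [ContinuousMap.inf_apply, ContinuousMap.add_apply]
        exact inf_le_right.trans (by linarith)
    · intro x _
      obtain ⟨g, hg, hfg, w, hw, hLw, hlt⟩ : ∃ g ∈ G, f ≤ g ∧ ∃ w : C(X, ℝ), 0 ≤ w ∧ L w = 0 ∧
          g x < f x + ε + w x := by
        by_cases hx : x ∈ mapSupport L
        · obtain ⟨g, hg, hfg, hlt⟩ := exists_mem_le_apply_lt heG he hf hx hε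
          exact ⟨g, hg, hfg, 0, le_rfl, map_zero L, by simpa using hlt⟩
        · simp only [mapSupport, Set.mem_ofPred_eq, not_forall] at hx
          obtain ⟨h, hLh, hhx⟩ := hx
          have hc : 0 ≤ (g₀ x - f x) / |h x| :=
            div_nonneg (sub_nonneg.2 (hfg₀ x)) (abs_nonneg _)
          refine ⟨g₀, hg₀, hfg₀, ((g₀ x - f x) / |h x|) • |h|, smul_nonneg hc (abs_nonneg h),
            by rw [map_smul, hLh, smul_zero], ?_⟩
          rw [ContinuousMap.smul_apply, ContinuousMap.abs_apply, smul_eq_mul,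
            div_mul_cancel₀ _ (abs_ne_zero.2 hhx)]
          linarith
      refine ⟨{y | g y < f y + ε + w y}, ?_, g, hGQ g hg hfg, w, hw, hLw, fun y hy => le_of_lt hy⟩
      rw [nhdsWithin_univ]
      exact (isOpen_lt g.continuous (by fun_prop)).mem_nhds hlt
  have hLq : L q ≤ L f + ε • L 1 := by
    have : q ≤ f + ε • 1 + w := fun x => by simpa using hqw x trivial
    simpa [hLw] using hL.monotone this
  obtain ⟨s, hs, hs0, hle⟩ := hq
  exact ⟨s, hs, hs0, fun i => (hle i).trans (add_le_add_left hLq _)⟩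

end ContinuousMap

theorem theorem1
    {X : Type*} [TopologicalSpace X] [CompactSpace X]
    {E : Type*} [AddCommGroup E] [Module ℝ E] [Lattice E] [IsOrderedAddMonoid E]
    [IsOrderedModule ℝ E] [TopologicalSpace E] [IsTopologicalAddGroup E] [ContinuousSMul ℝ E]
    {F : Type*} [AddCommGroup F] [Module ℝ F] [Lattice F] [IsOrderedAddMonoid F]
    [IsOrderedModule ℝ F] [UniformSpace F] [IsUniformAddGroup F] [ContinuousSMul ℝ F]
    [LocallyConvexSpace ℝ F] [LocallySolidSpace F]
    (T : C(X, ℝ) →ₗ[ℝ] E) (hT : IsVectorLatticeHom T)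
    (Tn : ℕ → E →ₚ[ℝ] F) (hTn : Equicontinuous (fun n : ℕ => (Tn n : E → F)))
    (P : E →L[ℝ] F) (hP : IsVectorLatticeHom (P : E →ₗ[ℝ] F))
    (S : Set C(X, ℝ)) (hS : ∃ g ∈ S, ∀ x, 0 < g x)
    (hconv : ∀ g ∈ S, Tendsto (fun n : ℕ => Tn n (T g)) atTop (𝓝 (P (T g)))) :
    ∀ f ∈ closure
        (T '' extensionSpace (Submodule.span ℝ S) (mapSupport ((P : E →ₗ[ℝ] F) ∘ₗ T))),
      Tendsto (fun n : ℕ => Tn n f) atTop (𝓝 (P f)) := by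
  obtain ⟨e, heS, he⟩ := hS
  have heG := Submodule.subset_span (R := ℝ) heS
  have hL := hP.comp hT
  have hconvG : ∀ g ∈ Submodule.span ℝ S,
      Tendsto (fun n => Tn n (T g)) atTop (𝓝 (((P : E →ₗ[ℝ] F) ∘ₗ T) g)) := by
    intro g hg
    induction hg using Submodule.span_induction with
    | mem g hg => exact hconv g hg
    | zero => simpa using tendsto_const_nhds
    | add g h _ _ hg hh => simpa using hg.add hh
    | smul c g _ hg => simpa using hg.const_smul c
  have hmono : ∀ n, Monotone fun g => Tn n (T g) := fun n => (Tn n).monotone'.comp hT.monotone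
  have hclosed := hTn.isClosed_setOfPred_tendsto (l := atTop) P.continuous
  suffices hsub : T '' extensionSpace (Submodule.span ℝ S) (mapSupport ((P : E →ₗ[ℝ] F) ∘ₗ T)) ⊆
      {f | Tendsto (fun n => Tn n f) atTop (𝓝 (P f))} from
    fun f hf => closure_minimal hsub hclosed hf
  refine Set.image_subset_iff.2 fun f hf => ?_
  rw [Set.mem_preimage, Set.mem_ofPred_eq, ← tendsto_sub_nhds_zero_iff]
  refine tendsto_zero_of_forall_abs_le (((P : E →ₗ[ℝ] F) ∘ₗ T) 1) fun ε hε => ?_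
  obtain ⟨s, hs, hs0, hle⟩ := exists_tendsto_zero_le_add heG he hL hmono hconvG hf hε
  obtain ⟨s', hs', hs0', hle'⟩ := exists_tendsto_zero_le_add heG he hL hmono hconvG
    (neg_mem_extensionSpace hf) hε
  refine ⟨fun n => s n + s' n, by simpa using hs.add hs', fun n => abs_le'.2 ⟨?_, ?_⟩⟩
  · have h1 := add_le_add (hle n) (hs0' n)
    rw [add_zero] at h1
    rw [sub_le_iff_le_add']
    refine h1.trans_eq ?_
    simp only [LinearMap.comp_apply, ContinuousLinearMap.coe_coe]
    abel
  · have h1 := add_le_add (hle' n) (hs0 n)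
    rw [add_zero, map_neg, map_neg, map_neg] at h1
    rw [neg_sub, sub_eq_add_neg, ← le_sub_iff_add_le']
    refine h1.trans_eq ?_
    simp only [LinearMap.comp_apply, ContinuousLinearMap.coe_coe]
    abel
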